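/- **Setting.** Fix a set of variables and a set $\mathcal L$ of connectives, each with a finite arity $\ge 0$; formulas are built as usual, $C^\circ$ denotes a formula with outermost connective $\circ$. A labelled formula is $\mathtt l A$ or $\mathtt r A$ (an occurrence of $A$ on the left or right); a sequent is a finite multiset of labelled formulas, and $\Gamma,\Delta$ denotes multiset sum. Notions such as (proper) subformula ignore labels; a proper subformula of $C$ is a subformula different from $C$. A *simple left rule* $R$ for $\circ$ consists of an arity $M\ge 0$, a set $\Lambda(R)$ of tuples $(\mathtt l C^\circ,\Lambda_1,\dots,\Lambda_M)$ in which every $\Lambda_m$ is a finite multiset of labelled proper subformulas of $C^\circ$, and a set $\mathcal C(R)$ of labelled formulas (the context restriction). Both sets are closed under replacing a variable by a formula, and every $C^\circ$ occurs in the first component of some tuple. Its instances infer $\Gamma,\mathtt l C^\circ$ from $\Gamma,\Lambda_1;\ \dots;\ \Gamma,\Lambda_M$, where the tuple is in $\Lambda(R)$ and all elements of $\Gamma$ are in $\mathcal C(R)$. Simple right rules are defined in the same way with $\mathtt r C^\circ$. A *standard calculus* has the initial sequents $\mathtt l x,\mathtt r x$ ($x$ a variable), weakening (from $\Gamma$ infer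 $\Gamma,\Delta$), contraction (from $\Gamma$ infer any $\Gamma^*\le\Gamma$ with the same support), multicut (from $\Gamma,\{\mathtt r C\}^p$ and $\Delta,\{\mathtt l C\}^q$ with $p,q\ne0$ infer $\Gamma,\Delta$; $C$ is the cut formula), and one simple left rule $(\circ\mathtt l)$ and one simple right rule $(\circ\mathtt r)$ for every $\circ\in\mathcal L$. A deduction from a set $\Omega$ of sequents is a finite tree of rule instances whose leaves are initial sequents or elements of $\Omega$; a proof is a deduction from $\emptyset$. A multicut is *analytic* if its cut formula is a subformula of some formula in its conclusion; a deduction is *locally analytic* if all its multicuts are analytic, and *cut-free* if it has no multicut. The *degree* of a multicut is the number of symbols (occurrences of variables and connectives) of its cut formula; its *rank* is the number of sequents above it in the deduction. A proof is *$(d,r)$-reduced* if every non-analytic multicut in it has degree $\le d$, and every non-analytic multicut in it of degree $d$ has rank $<r$ and is not below any other non-analytic multicut. Write $\bar{\mathtt l}=\mathtt r$, $\bar{\mathtt r}=\mathtt l$, and $\overline{\mathcal C}$ for $\mathcal C$ with all labels swapped. A connective $\circ$ of a standard calculus is * *left-invertible* if for all $(\mathtt l C^\circ,\Lambda_1,\dots,\Lambda_M)\in\Lambda(\circ\mathtt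 l)$, all $\Gamma$, all proofs $\beta$ of $\Gamma,\mathtt l C^\circ$ and all $m\le M$ there is a proof $\beta_m$ of $\Gamma,\Lambda_m$ that is cut-free if $\beta$ is, and that, if $\beta$ is locally analytic, is locally analytic apart from possibly some multicuts on proper subformulas of $C^\circ$; * *leftable* if, for every $C^\circ$ and every simple rule $R$ of the calculus, $\mathtt l C^\circ\in\mathcal C(R)$ implies that $\mathcal C(R)$ is the set of all labelled formulas; * *weakly leftable* if, for all such $C^\circ$ and $R$, $\mathtt l C^\circ\in\mathcal C(R)$ implies $\mathcal C(\circ\mathtt r)\subseteq\mathcal C(R)$; * *inverse leftable* if, for all such $C^\circ$ and $R$, $\mathtt l C^\circ\in\mathcal C(R)$ implies $\overline{\mathcal C(\circ\mathtt l)}\subseteq\mathcal C(R)$; and *right-invertible*, *rightable*, *weakly rightable*, *inverse rightable* are defined by exchanging $\mathtt l$ and $\mathtt r$ throughout as labels of the principal formula and as names of rules. A connective is *class 2* if it is (1) left- and right-invertible, or (2) leftable and weakly rightable, or (3) rightable and weakly leftable, or (4) weakly leftable and inverse rightable, or (5) weakly rightable and inverse leftable. A standard calculus is *class 2* if the empty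 sequent has no proof; $\mathtt l A,\mathtt r A$ has a cut-free proof for every formula $A$; for every connective $\circ$, whenever $(\mathtt l C^\circ,\Lambda_1,\dots,\Lambda_M)\in\Lambda(\circ\mathtt l)$ and $(\mathtt r C^\circ,\Sigma_1,\dots,\Sigma_N)\in\Lambda(\circ\mathtt r)$, there is a deduction of the empty sequent from $\Lambda_1,\dots,\Lambda_M,\Sigma_1,\dots,\Sigma_N$ using only structural rules (weakening, contraction, multicut); and every connective is class 2. **Lemma (Reduction Lemma).** Let $\beta$ be a proof in a class 2 standard calculus whose last inference is a non-analytic multicut of degree $d$ and rank $r$, all other multicuts in $\beta$ being analytic. Then there is a $(d,r)$-reduced proof $\beta'$ with the same endsequent as $\beta$. -/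

import Mathlib

namespace CutRestriction

universe u v

/-- A propositional language: connectives with their arities. -/
structure PropLanguage where
  Conn : Type v
  arity : Conn → ℕ

/-- Formulas over the variables `V` and the connectives of `L`. -/
inductive Formula (V : Type u) (L : PropLanguage.{v}) : Type (max u v)
  | var (x : V) : Formula V L
  | app (c : L.Conn) (args : Fin (L.arity c) → Formula V L) : Formula V L

namespace Formula

variable {V : Type u} {L : PropLanguage.{v}}

/-- The formula has principal (outermost) connective `c`. -/
def HasPrincipal (c : L.Conn) (C : Formula V L) : Prop :=
  ∃ args : Fin (L.arity c) → Formula V L, C = app c args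

/-- `Subformula A B`: `A` is a subformula of `B`. -/
inductive Subformula : Formula V L → Formula V L → Prop
  | refl (A : Formula V L) : Subformula A A
  | arg {A : Formula V L} (c : L.Conn) (args : Fin (L.arity c) → Formula V L)
      (i : Fin (L.arity c)) (h : Subformula A (args i)) : Subformula A (app c args)

/-- `ProperSubformula A B`: `A` is a subformula of `B` different from `B`. -/
def ProperSubformula (A B : Formula V L) : Prop :=
  Subformula A B ∧ A ≠ B

/-- The number of symbols (occurrences of variables and connectives). -/
def symbols : Formula V L → ℕ
  | var _ => 1
  | app _ args => 1 + ∑ i, (args i).symbols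

open Classical in
/-- Replace all occurrences of the variable `x` by the formula `A`. -/
noncomputable def subst (x : V) (A : Formula V L) : Formula V L → Formula V L
  | var y => if y = x then A else var y
  | app c args => app c (fun i => subst x A (args i))

end Formula

/-- The two labels: left (antecedent) and right (succedent). -/
inductive Side
  | left
  | right

/-- The other label. -/
def Side.flip : Side → Side
  | Side.left => Side.right
  | Side.right => Side.left

/-- A labelled formula. -/
structure LFormula (V : Type u) (L : PropLanguage.{v}) : Type (max u v) where
  side : Side
  form : Formula V L

/-- The labelled formula with the other label. -/
def LFormula.flip {V : Type u} {L : PropLanguage.{v}} (a : LFormula V L) : LFormula V L :=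
  ⟨a.side.flip, a.form⟩

/-- Uniform substitution in a labelled formula. -/
noncomputable def LFormula.subst {V : Type u} {L : PropLanguage.{v}} (x : V) (A : Formula V L)
    (a : LFormula V L) : LFormula V L :=
  ⟨a.side, Formula.subst x A a.form⟩

/-- A sequent is a finite multiset of labelled formulas. -/
abbrev Sequent (V : Type u) (L : PropLanguage.{v}) : Type (max u v) :=
  Multiset (LFormula V L)

/-- `IsContraction Γ' Γ`: `Γ'` is a contraction of `Γ`, i.e. both have the same support and
every element occurs in `Γ` at least as often as in `Γ'`. -/
def IsContraction {V : Type u} {L : PropLanguage.{v}} (Γ' Γ : Sequent V L) : Prop :=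
  (∀ a, a ∈ Γ' ↔ a ∈ Γ) ∧ Γ' ≤ Γ

/-- A simple rule on side `k` for the connective `c`. An element `(C, Λ)` of `tuples` stands for
the principal formula `C` labelled `k` with the multisets `Λ 0, …, Λ (M - 1)` of auxiliary
formulas, where `M` is the arity of the rule; `context` is the context restriction. -/
structure SimpleRule (V : Type u) (L : PropLanguage.{v}) (k : Side) (c : L.Conn) where
  arity : ℕ
  tuples : Set (Formula V L × (Fin arity → Sequent V L))
  context : Set (LFormula V L)
  principal : ∀ C Λ, (C, Λ) ∈ tuples → C.HasPrincipal c
  auxiliary : ∀ C Λ, (C, Λ) ∈ tuples → ∀ m, ∀ a ∈ Λ m, a.form.ProperSubformula C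
  tuples_subst : ∀ (x : V) (A : Formula V L) (C : Formula V L) (Λ : Fin arity → Sequent V L),
    (C, Λ) ∈ tuples → (Formula.subst x A C, fun m => (Λ m).map (LFormula.subst x A)) ∈ tuples
  context_subst : ∀ (x : V) (A : Formula V L), ∀ a ∈ context, LFormula.subst x A a ∈ context
  total : ∀ C : Formula V L, C.HasPrincipal c → ∃ Λ, (C, Λ) ∈ tuples

/-- A standard calculus: one simple left rule and one simple right rule for every connective.
The initial sequents and the structural rules are the same for all standard calculi, see
`Deduction`. -/
structure StandardCalculus (V : Type u) (L : PropLanguage.{v}) where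
  rule : ∀ (k : Side) (c : L.Conn), SimpleRule V L k c

variable {V : Type u} {L : PropLanguage.{v}}

/-- Deductions (trees of rule instances) of a sequent from the sequents in `Ω`. -/
inductive Deduction (S : StandardCalculus V L) (Ω : Set (Sequent V L)) :
    Sequent V L → Type (max u v)
  | assumption {Θ : Sequent V L} (h : Θ ∈ Ω) : Deduction S Ω Θ
  | ident {Θ : Sequent V L} (x : V)
      (h : Θ = {⟨Side.left, Formula.var x⟩, ⟨Side.right, Formula.var x⟩}) : Deduction S Ω Θ
  | weakening {Θ : Sequent V L} (Γ Δ : Sequent V L) (h : Θ = Γ + Δ)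
      (D : Deduction S Ω Γ) : Deduction S Ω Θ
  | contraction {Θ : Sequent V L} (Γ : Sequent V L) (h : IsContraction Θ Γ)
      (D : Deduction S Ω Γ) : Deduction S Ω Θ
  | mcut {Θ : Sequent V L} (Γ Δ : Sequent V L) (C : Formula V L) (p q : ℕ)
      (hp : p ≠ 0) (hq : q ≠ 0) (h : Θ = Γ + Δ)
      (D₁ : Deduction S Ω (Γ + Multiset.replicate p ⟨Side.right, C⟩))
      (D₂ : Deduction S Ω (Δ + Multiset.replicate q ⟨Side.left, C⟩)) : Deduction S Ω Θ
  | logical {Θ : Sequent V L} (k : Side) (c : L.Conn) (Γ : Sequent V L) (C : Formula V L)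
      (Λ : Fin (S.rule k c).arity → Sequent V L) (ht : (C, Λ) ∈ (S.rule k c).tuples)
      (hΓ : ∀ a ∈ Γ, a ∈ (S.rule k c).context) (h : Θ = Γ + {⟨k, C⟩})
      (D : ∀ m, Deduction S Ω (Γ + Λ m)) : Deduction S Ω Θ

/-- Proofs are deductions without assumptions. -/
abbrev Proof (S : StandardCalculus V L) (Θ : Sequent V L) : Type (max u v) :=
  Deduction S ∅ Θ

/-- A multicut with cut formula `C` and conclusion `Θ` is analytic. -/
def AnalyticCut (C : Formula V L) (Θ : Sequent V L) : Prop :=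
  ∃ a ∈ Θ, C.Subformula a.form

namespace Deduction

variable {S : StandardCalculus V L} {Ω : Set (Sequent V L)}

/-- The number of sequents in a deduction (the endsequent included). -/
def size : ∀ {Θ : Sequent V L}, Deduction S Ω Θ → ℕ
  | _, assumption _ => 1
  | _, ident _ _ => 1
  | _, weakening _ _ _ D => 1 + D.size
  | _, contraction _ _ D => 1 + D.size
  | _, mcut _ _ _ _ _ _ _ _ D₁ D₂ => 1 + (D₁.size + D₂.size)
  | _, logical _ _ _ _ _ _ _ _ D => 1 + ∑ m, (D m).size

/-- `P C Θ` holds for every multicut in the deduction, `C` being its cut formula and `Θ` its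
conclusion. -/
def AllCuts (P : Formula V L → Sequent V L → Prop) :
    ∀ {Θ : Sequent V L}, Deduction S Ω Θ → Prop
  | _, assumption _ => True
  | _, ident _ _ => True
  | _, weakening _ _ _ D => D.AllCuts P
  | _, contraction _ _ D => D.AllCuts P
  | Θ, mcut _ _ C _ _ _ _ _ D₁ D₂ => P C Θ ∧ D₁.AllCuts P ∧ D₂.AllCuts P
  | _, logical _ _ _ _ _ _ _ _ D => ∀ m, (D m).AllCuts P

/-- The deduction uses no multicut. -/
def CutFree {Θ : Sequent V L} (D : Deduction S Ω Θ) : Prop :=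
  D.AllCuts (fun _ _ => False)

/-- All multicuts are analytic. -/
def LocallyAnalytic {Θ : Sequent V L} (D : Deduction S Ω Θ) : Prop :=
  D.AllCuts AnalyticCut

/-- The deduction is locally analytic apart from possibly some multicuts on proper subformulas
of `C`. -/
def LocallyAnalyticUpTo (C : Formula V L) {Θ : Sequent V L} (D : Deduction S Ω Θ) : Prop :=
  D.AllCuts (fun A Ξ => AnalyticCut A Ξ ∨ A.ProperSubformula C)

/-- The deduction uses no logical rule. -/
def OnlyStructural : ∀ {Θ : Sequent V L}, Deduction S Ω Θ → Prop
  | _, assumption _ => True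
  | _, ident _ _ => True
  | _, weakening _ _ _ D => D.OnlyStructural
  | _, contraction _ _ D => D.OnlyStructural
  | _, mcut _ _ _ _ _ _ _ _ D₁ D₂ => D₁.OnlyStructural ∧ D₂.OnlyStructural
  | _, logical _ _ _ _ _ _ _ _ _ => False

/-- `(d, r)`-reduced: every non-analytic multicut has degree at most `d`, and if it has degree
`d` then its rank (the number of sequents above it) is less than `r` and no other non-analytic
multicut is above it, i.e. the deductions of both premises are locally analytic. -/
def Reduced (d r : ℕ) : ∀ {Θ : Sequent V L}, Deduction S Ω Θ → Prop
  | _, assumption _ => True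
  | _, ident _ _ => True
  | _, weakening _ _ _ D => D.Reduced d r
  | _, contraction _ _ D => D.Reduced d r
  | Θ, mcut _ _ C _ _ _ _ _ D₁ D₂ =>
      (¬ AnalyticCut C Θ → C.symbols ≤ d ∧
        (C.symbols = d → D₁.size + D₂.size < r ∧ D₁.LocallyAnalytic ∧ D₂.LocallyAnalytic)) ∧
      D₁.Reduced d r ∧ D₂.Reduced d r
  | _, logical _ _ _ _ _ _ _ _ D => ∀ m, (D m).Reduced d r

/-- The last inference is a non-analytic multicut of degree `d` and rank `r`, and all other
multicuts are analytic. -/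
def OnlyLastCutNonAnalytic (d r : ℕ) : ∀ {Θ : Sequent V L}, Deduction S Ω Θ → Prop
  | Θ, mcut _ _ C _ _ _ _ _ D₁ D₂ =>
      ¬ AnalyticCut C Θ ∧ C.symbols = d ∧ D₁.size + D₂.size = r ∧
        D₁.LocallyAnalytic ∧ D₂.LocallyAnalytic
  | _, _ => False

end Deduction

namespace StandardCalculus

variable (S : StandardCalculus V L)

/-- Every sequent consisting of a formula on both sides has a cut-free proof. -/
def AxiomExpansion : Prop :=
  ∀ A : Formula V L, ∃ D : Proof S {⟨Side.left, A⟩, ⟨Side.right, A⟩}, D.CutFree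

/-- From the auxiliary formulas of a left and a right inference with the same principal formula
the empty sequent can be deduced by structural rules. -/
def PrincipalCaseReductions : Prop :=
  ∀ (c : L.Conn) (C : Formula V L) (Λ : Fin (S.rule Side.left c).arity → Sequent V L)
    (Ξ : Fin (S.rule Side.right c).arity → Sequent V L),
    (C, Λ) ∈ (S.rule Side.left c).tuples → (C, Ξ) ∈ (S.rule Side.right c).tuples →
      ∃ D : Deduction S (Set.range Λ ∪ Set.range Ξ) 0, D.OnlyStructural

/-- The empty sequent has no proof. -/
def Consistent : Prop :=
  IsEmpty (Proof S 0)

/-- Left-invertible (`k = left`) and right-invertible (`k = right`) connectives. -/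
def Invertible (k : Side) (c : L.Conn) : Prop :=
  ∀ (C : Formula V L) (Λ : Fin (S.rule k c).arity → Sequent V L),
    (C, Λ) ∈ (S.rule k c).tuples →
    ∀ (Γ : Sequent V L) (β : Proof S (Γ + {⟨k, C⟩})) (m : Fin (S.rule k c).arity),
      ∃ β' : Proof S (Γ + Λ m),
        (β.CutFree → β'.CutFree) ∧ (β.LocallyAnalytic → β'.LocallyAnalyticUpTo C)

/-- Leftable (`k = left`) and rightable (`k = right`) connectives. -/
def Shiftable (k : Side) (c : L.Conn) : Prop :=
  ∀ C : Formula V L, C.HasPrincipal c → ∀ (k' : Side) (c' : L.Conn),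
    (⟨k, C⟩ : LFormula V L) ∈ (S.rule k' c').context → (S.rule k' c').context = Set.univ

/-- Weakly leftable (`k = left`) and weakly rightable (`k = right`) connectives: the contexts of
the rule for `c` on the other side may replace `C` labelled `k`. -/
def WeaklyShiftable (k : Side) (c : L.Conn) : Prop :=
  ∀ C : Formula V L, C.HasPrincipal c → ∀ (k' : Side) (c' : L.Conn),
    (⟨k, C⟩ : LFormula V L) ∈ (S.rule k' c').context →
      (S.rule k.flip c).context ⊆ (S.rule k' c').context

/-- Inverse leftable (`k = left`) and inverse rightable (`k = right`) connectives: the contexts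
of the rule for `c` on the same side may, with labels swapped, replace `C` labelled `k`. -/
def InverseShiftable (k : Side) (c : L.Conn) : Prop :=
  ∀ C : Formula V L, C.HasPrincipal c → ∀ (k' : Side) (c' : L.Conn),
    (⟨k, C⟩ : LFormula V L) ∈ (S.rule k' c').context →
      LFormula.flip '' (S.rule k c).context ⊆ (S.rule k' c').context

/-- Class 1 connectives. -/
def IsClassOneConn (c : L.Conn) : Prop :=
  (S.Invertible Side.left c ∧ S.Invertible Side.right c) ∨
  (S.Shiftable Side.left c ∧ S.WeaklyShiftable Side.right c) ∨
  (S.Shiftable Side.right c ∧ S.WeaklyShiftable Side.left c)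

/-- Class 2 connectives. -/
def IsClassTwoConn (c : L.Conn) : Prop :=
  S.IsClassOneConn c ∨
  (S.WeaklyShiftable Side.left c ∧ S.InverseShiftable Side.right c) ∨
  (S.WeaklyShiftable Side.right c ∧ S.InverseShiftable Side.left c)

/-- Class 2 calculi. -/
def IsClassTwo : Prop :=
  S.Consistent ∧ S.PrincipalCaseReductions ∧ S.AxiomExpansion ∧ ∀ c, S.IsClassTwoConn c

end StandardCalculus

end CutRestriction

/-! By weakening and contraction only the support of a sequent matters, so cuts are handled through
premises whose elements lie in the target `Θ` except for the labelled cut formula (`CoveredBy`). A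
`(d, r)`-reduced proof may contain three kinds of cuts: analytic ones, ones of degree below `d`, and
ones of degree `d` with rank below `r` and locally analytic premises. Hence no induction on the rank
is needed: the given cut is traded once for cuts of these kinds.

If the connective of `C` is invertible on both sides, inversion and the principal case reduction
suffice. If `C` is principal at the end of both premises, each premise of one final inference is cut
against the whole other proof, and the principal case reduction finishes (`of_endsIn`). If `C` is
not principal at the end of a premise, the cut moves above that last inference, provided that the
other formulas of the opposite premise satisfy its context restriction (`of_not_endsIn`); (weak)
leftability or rightability guarantees this.

In the inverse case this can be blocked. Then `C` is traced upwards in the blocking proof to the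
inferences where it is principal, with contexts `G`. Cutting the subproofs ending there against the
other premise proves `Θ + G`, with smaller rank. Replacing `C` by a selection `T` of one flipped
formula from each `G` turns those inferences into weakened identities, and inverse leftability or
rightability lets `T` pass the rules in between. Cuts over all selections yield `Θ`
(`exists_principal_contexts`, `cut_transversal`). -/

namespace CutRestriction

open Multiset

variable {V : Type*} {L : PropLanguage}

/-! ### Subformulas and degree -/

namespace Formula

theorem Subformula.trans {A B C : Formula V L} (h : A.Subformula B) (h' : B.Subformula C) :
    A.Subformula C := by
  induction h' with
  | refl => exact h
  | arg c args i _ ih => exact .arg c args i ih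

theorem Subformula.eq_or_symbols_lt {A B : Formula V L} (h : A.Subformula B) :
    A = B ∨ A.symbols < B.symbols := by
  induction h with
  | refl => exact .inl rfl
  | arg c args i _ ih =>
    right
    have h1 : (args i).symbols ≤ ∑ j, (args j).symbols :=
      Finset.single_le_sum (f := fun j => (args j).symbols) (fun _ _ => Nat.zero_le _)
        (Finset.mem_univ i)
    simp only [symbols]
    rcases ih with rfl | ih <;> omega

theorem ProperSubformula.symbols_lt {A B : Formula V L} (h : A.ProperSubformula B) :
    A.symbols < B.symbols :=
  h.1.eq_or_symbols_lt.resolve_left h.2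

theorem ProperSubformula.trans_left {A B C : Formula V L} (h : A.Subformula B)
    (h' : B.ProperSubformula C) : A.ProperSubformula C := by
  refine ⟨h.trans h'.1, ?_⟩
  rintro rfl
  have := h'.symbols_lt
  rcases h.eq_or_symbols_lt with rfl | h
  · exact h'.2 rfl
  · omega

theorem HasPrincipal.unique {c c' : L.Conn} {C : Formula V L} (h : C.HasPrincipal c)
    (h' : C.HasPrincipal c') : c = c' := by
  obtain ⟨a, rfl⟩ := h
  obtain ⟨a', h'⟩ := h'
  cases h'
  rfl

end Formula

@[simp]
theorem Side.flip_flip (k : Side) : k.flip.flip = k := by cases k <;> rfl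

theorem Side.flip_ne (k : Side) : k.flip ≠ k := by cases k <;> simp [Side.flip]

theorem flip_mem_ident {k : Side} {A C : Formula V L}
    (h : ⟨k, C⟩ ∈ ({⟨Side.left, A⟩, ⟨Side.right, A⟩} : Sequent V L)) :
    ⟨k.flip, C⟩ ∈ ({⟨Side.left, A⟩, ⟨Side.right, A⟩} : Sequent V L) := by
  cases k <;> simpa [Side.flip] using h

/-- Every element of `Θ'` other than `a` belongs to `Θ`. -/
def CoveredBy (a : LFormula V L) (Θ' Θ : Sequent V L) : Prop :=
  ∀ b ∈ Θ', b = a ∨ b ∈ Θ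

/-! ### Locally analytic deductions and their last inferences -/

namespace Deduction

variable {S : StandardCalculus V L} {Ω : Set (Sequent V L)}

/-- The last inference is a logical rule with principal formula `C` labelled `k`. -/
def EndsIn (k : Side) (C : Formula V L) : ∀ {Θ : Sequent V L}, Deduction S Ω Θ → Prop
  | _, logical k' _ _ C' _ _ _ _ _ => k' = k ∧ C' = C
  | _, _ => False

theorem AllCuts.mono {P Q : Formula V L → Sequent V L → Prop} (h : ∀ C Θ, P C Θ → Q C Θ)
    {Θ : Sequent V L} {D : Deduction S Ω Θ} (hD : D.AllCuts P) : D.AllCuts Q := by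
  induction D with
  | assumption => trivial
  | ident => trivial
  | weakening _ _ _ _ ih => exact ih hD
  | contraction _ _ _ ih => exact ih hD
  | mcut _ _ _ _ _ _ _ _ _ _ ih₁ ih₂ => exact ⟨h _ _ hD.1, ih₁ hD.2.1, ih₂ hD.2.2⟩
  | logical _ _ _ _ _ _ _ _ _ ih => exact fun m => ih m (hD m)

theorem AllCuts.reduced {d : ℕ} (r : ℕ) {Θ : Sequent V L} {D : Deduction S Ω Θ}
    (hD : D.AllCuts fun C Ξ => AnalyticCut C Ξ ∨ C.symbols < d) : D.Reduced d r := by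
  induction D with
  | assumption => trivial
  | ident => trivial
  | weakening _ _ _ _ ih => exact ih hD
  | contraction _ _ _ ih => exact ih hD
  | mcut _ _ _ _ _ _ _ _ _ _ ih₁ ih₂ =>
    refine ⟨fun hn => ?_, ih₁ hD.2.1, ih₂ hD.2.2⟩
    have := hD.1.resolve_left hn
    exact ⟨this.le, fun h => absurd h this.ne⟩
  | logical _ _ _ _ _ _ _ _ _ ih => exact fun m => ih m (hD m)

theorem LocallyAnalytic.reduced {Θ : Sequent V L} {D : Deduction S Ω Θ}
    (hD : D.LocallyAnalytic) (d r : ℕ) : D.Reduced d r :=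
  AllCuts.reduced r (AllCuts.mono (fun _ _ => Or.inl) hD)

theorem size_lt_logical {k : Side} {c : L.Conn} {Γ Θ : Sequent V L} {C : Formula V L}
    {Λ : Fin (S.rule k c).arity → Sequent V L} {ht : (C, Λ) ∈ (S.rule k c).tuples}
    {hΓ : ∀ a ∈ Γ, a ∈ (S.rule k c).context} {h : Θ = Γ + {⟨k, C⟩}}
    (D : ∀ m, Deduction S Ω (Γ + Λ m)) (m : Fin (S.rule k c).arity) :
    (D m).size < (logical k c Γ C Λ ht hΓ h D).size := by
  have : (D m).size ≤ ∑ m, (D m).size :=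
    Finset.single_le_sum (f := fun j => (D j).size) (fun _ _ => Nat.zero_le _) (Finset.mem_univ m)
  simp only [size]
  omega

/-- The premises of a locally analytic proof ending in a rule with principal formula `C`. -/
theorem EndsIn.exists_premises {k : Side} {C : Formula V L} {Θ : Sequent V L}
    {D : Deduction S Ω Θ} (h : D.EndsIn k C) (hD : D.LocallyAnalytic) :
    ∃ (c : L.Conn) (Γ : Sequent V L) (Λ : Fin (S.rule k c).arity → Sequent V L),
      (C, Λ) ∈ (S.rule k c).tuples ∧ (∀ a ∈ Γ, a ∈ (S.rule k c).context) ∧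
      Θ = Γ + {⟨k, C⟩} ∧
      ∀ m, ∃ D' : Deduction S Ω (Γ + Λ m), D'.LocallyAnalytic ∧ D'.size < D.size := by
  cases D with
  | logical k' c Γ C' Λ ht hΓ hΘ D =>
    obtain ⟨rfl, rfl⟩ := h
    exact ⟨c, Γ, Λ, ht, hΓ, hΘ, fun m => ⟨D m, hD m, size_lt_logical D m⟩⟩
  | _ => exact h.elim

theorem EndsIn.mem_context {c : L.Conn} {k : Side} {C : Formula V L}
    {Θ : Sequent V L} {D : Deduction S Ω Θ}
    (h : D.EndsIn k C) (hD : D.LocallyAnalytic) (hCc : C.HasPrincipal c) :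
    ∀ a ∈ Θ, a ≠ ⟨k, C⟩ → a ∈ (S.rule k c).context := by
  obtain ⟨c', Γ, Λ, ht, hΓ, rfl, -⟩ := h.exists_premises hD
  obtain rfl := hCc.unique ((S.rule _ _).principal _ _ ht)
  intro a ha hne
  exact hΓ a ((mem_add.1 ha).resolve_right fun h => hne (mem_singleton.1 h))

end Deduction

open Deduction

/-- There is a `(d, r)`-reduced proof of `Θ`. -/
def ReducedProvable (S : StandardCalculus V L) (d r : ℕ) (Θ : Sequent V L) : Prop :=
  ∃ D : Proof S Θ, D.Reduced d r

/-! ### Rules preserving reduced provability -/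

namespace ReducedProvable

variable {S : StandardCalculus V L} {d r : ℕ}

theorem mono {Γ Θ : Sequent V L} (h : ReducedProvable S d r Γ) (hs : Γ ⊆ Θ) :
    ReducedProvable S d r Θ := by
  obtain ⟨D, hD⟩ := h
  have hc : IsContraction Θ (Γ + Θ) := by
    refine ⟨fun a => ?_, Multiset.le_add_left _ _⟩
    rw [mem_add]
    exact ⟨.inr, fun h => h.elim (fun h => hs h) id⟩
  exact ⟨.contraction (Γ + Θ) hc (.weakening Γ Θ rfl D), hD⟩

/-- Analyticity or low degree exempts this cut from the rank condition, so its premises need only be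
reduced and may themselves contain cuts of degree `d`. -/
theorem cut {Γ₁ Γ₂ Θ : Sequent V L} {E : Formula V L} (k : Side)
    (h₁ : ReducedProvable S d r Γ₁) (h₂ : ReducedProvable S d r Γ₂)
    (c₁ : CoveredBy ⟨k, E⟩ Γ₁ Θ) (c₂ : CoveredBy ⟨k.flip, E⟩ Γ₂ Θ)
    (hE : AnalyticCut E Θ ∨ E.symbols < d) : ReducedProvable S d r Θ := by
  wlog hk : k = Side.right generalizing k Γ₁ Γ₂
  · refine this k.flip h₂ h₁ c₂ (by simpa using c₁) ?_
    cases k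
    · rfl
    · exact absurd rfl hk
  subst hk
  have key : ∀ {Γ : Sequent V L} {k : Side}, CoveredBy ⟨k, E⟩ Γ Θ →
      Γ ⊆ Θ + replicate 1 ⟨k, E⟩ := by
    intro Γ k c a ha
    rcases c a ha with h | h <;> simp [h]
  obtain ⟨D₁, hD₁⟩ := h₁.mono (key c₁)
  obtain ⟨D₂, hD₂⟩ := h₂.mono (key c₂)
  refine mono (Γ := Θ + Θ) ⟨.mcut Θ Θ E 1 1 one_ne_zero one_ne_zero rfl D₁ D₂, fun hn => ?_,
    hD₁, hD₂⟩ (by intro a; simp)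
  have : E.symbols < d := by
    refine hE.resolve_left fun ⟨a, ha, hs⟩ => hn ⟨a, ?_, hs⟩
    simp [ha]
  exact ⟨this.le, fun h => absurd h this.ne⟩

theorem logical {k : Side} {c : L.Conn} {Γ Θ : Sequent V L} {C : Formula V L}
    {Λ : Fin (S.rule k c).arity → Sequent V L} (ht : (C, Λ) ∈ (S.rule k c).tuples)
    (hΓ : ∀ a ∈ Γ, a ∈ (S.rule k c).context) (hs : Γ ⊆ Θ) (hC : ⟨k, C⟩ ∈ Θ)
    (h : ∀ m, ReducedProvable S d r (Γ + Λ m)) : ReducedProvable S d r Θ := by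
  choose D hD using h
  have h : ReducedProvable S d r (Γ + {⟨k, C⟩}) := ⟨.logical k c Γ C Λ ht hΓ rfl D, hD⟩
  refine h.mono fun a ha => ?_
  rcases mem_add.1 ha with h | h
  · exact hs h
  · rw [mem_singleton.1 h]
    exact hC

/-- A multicut of degree `d` and rank below `r` with locally analytic premises. -/
theorem mcut {C : Formula V L} {Θ₁ Θ₂ Θ : Sequent V L} (k : Side) (hd : C.symbols = d)
    (D₁ : Proof S Θ₁) (D₂ : Proof S Θ₂) (h₁ : D₁.LocallyAnalytic) (h₂ : D₂.LocallyAnalytic)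
    (hr : D₁.size + D₂.size < r) (c₁ : CoveredBy ⟨k, C⟩ Θ₁ Θ)
    (c₂ : CoveredBy ⟨k.flip, C⟩ Θ₂ Θ) : ReducedProvable S d r Θ := by
  classical
  wlog hk : k = Side.right generalizing k Θ₁ Θ₂
  · refine this k.flip D₂ D₁ h₂ h₁ (by omega) c₂ (by simpa using c₁) ?_
    cases k
    · rfl
    · exact absurd rfl hk
  subst hk
  -- The multicut rule needs a copy of `C` in each premise; a premise without one already yields `Θ`
  -- by weakening and contraction.
  by_cases m₁ : ⟨Side.right, C⟩ ∈ Θ₁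
  swap
  · exact mono ⟨D₁, h₁.reduced d r⟩ fun a ha =>
      (c₁ a ha).resolve_left (by rintro rfl; exact m₁ ha)
  by_cases m₂ : ⟨Side.left, C⟩ ∈ Θ₂
  swap
  · exact mono ⟨D₂, h₂.reduced d r⟩ fun a ha =>
      (c₂ a ha).resolve_left (by rintro rfl; exact m₂ ha)
  -- All copies of the cut formula are removed at once: `p` and `q` are its full multiplicities.
  have split : ∀ (Ξ : Sequent V L) (a : LFormula V L),
      Ξ = Ξ.filter (fun b => ¬ a = b) + replicate (Ξ.count a) a := by
    intro Ξ a
    rw [← filter_eq, add_comm]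
    exact (filter_add_not _ Ξ).symm
  have e₁ := split Θ₁ ⟨Side.right, C⟩
  have e₂ := split Θ₂ ⟨Side.left, C⟩
  have n₁ := (count_pos.2 m₁).ne'
  have n₂ := (count_pos.2 m₂).ne'
  generalize count _ Θ₁ = p at e₁ n₁
  generalize count _ Θ₂ = q at e₂ n₂
  have s₁ : Θ₁.filter (fun b => ¬ ⟨Side.right, C⟩ = b) ⊆ Θ := fun a ha =>
    (c₁ a (mem_filter.1 ha).1).resolve_left fun h => (mem_filter.1 ha).2 h.symm
  have s₂ : Θ₂.filter (fun b => ¬ ⟨Side.left, C⟩ = b) ⊆ Θ := fun a ha =>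
    (c₂ a (mem_filter.1 ha).1).resolve_left fun h => (mem_filter.1 ha).2 h.symm
  generalize Θ₁.filter (fun b => ¬ ⟨Side.right, C⟩ = b) = Γ at e₁ s₁
  generalize Θ₂.filter (fun b => ¬ ⟨Side.left, C⟩ = b) = Δ at e₂ s₂
  subst e₁ e₂
  refine mono (Γ := Γ + Δ) ⟨.mcut Γ Δ C p q n₁ n₂ rfl D₁ D₂, fun _ => ⟨hd.le, fun _ =>
    ⟨hr, h₁, h₂⟩⟩, h₁.reduced d r, h₂.reduced d r⟩ fun a ha => ?_
  exact (mem_add.1 ha).elim (fun h => s₁ h) (fun h => s₂ h)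

/-- Successive cuts with all elements of `G`. -/
theorem cut_all {Θ : Sequent V L} (G : Sequent V L) (h : ReducedProvable S d r (Θ + G))
    (hG : ∀ a ∈ G, ReducedProvable S d r (Θ + {a.flip}))
    (hU : ∀ a ∈ G, AnalyticCut a.form Θ ∨ a.form.symbols < d) : ReducedProvable S d r Θ := by
  induction G using Multiset.induction_on with
  | empty => simpa using h
  | cons a G ih =>
    refine ih ?_ (fun b hb => hG b (mem_cons_of_mem hb)) fun b hb => hU b (mem_cons_of_mem hb)
    refine cut (E := a.form) a.side h (hG a (mem_cons_self a G)) ?_ ?_ ?_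
    · intro b hb
      simp only [mem_add, mem_cons] at hb ⊢
      rcases hb with hb | rfl | hb
      · exact .inr (.inl hb)
      · exact .inl rfl
      · exact .inr (.inr hb)
    · intro b hb
      simp only [mem_add, mem_singleton] at hb ⊢
      rcases hb with hb | rfl
      · exact .inr (.inl hb)
      · exact .inl rfl
    · refine (hU a (mem_cons_self a G)).imp_left fun ⟨b, hb, hs⟩ => ⟨b, ?_, hs⟩
      exact mem_add.2 (.inl hb)

/-! ### Principal case reductions -/

/-- A structural deduction can be simulated in a context so that only formulas of its
assumptions are cut. -/
theorem of_onlyStructural {Θ : Sequent V L} {Ω : Set (Sequent V L)}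
    (hΩ : ∀ Λ ∈ Ω, ReducedProvable S d r (Θ + Λ) ∧ ∀ a ∈ Λ, a.form.symbols < d)
    {Ξ : Sequent V L} (D : Deduction S Ω Ξ) (hD : D.OnlyStructural) :
    (∃ A, ⟨Side.left, A⟩ ∈ Ξ ∧ ⟨Side.right, A⟩ ∈ Ξ) ∨
      ∃ Ξ' ⊆ Ξ, (∀ a ∈ Ξ', a.form.symbols < d) ∧ ReducedProvable S d r (Θ + Ξ') := by
  -- Weakening and initial sequents may bring in cut formulas of any size. The invariant avoids
  -- cutting them: either the sequent has a formula on both sides, or it contains a part `Ξ'` of low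
  -- degree that is provable next to `Θ`. A multicut with a premise of the first kind needs no
  -- actual cut.
  induction D with
  | assumption h => exact .inr ⟨_, Subset.refl _, (hΩ _ h).2, (hΩ _ h).1⟩
  | ident x h => exact .inl ⟨.var x, by simp [h], by simp [h]⟩
  | weakening Γ Δ h D ih =>
    subst h
    have hs : Γ ⊆ Γ + Δ := fun a ha => mem_add.2 (.inl ha)
    rcases ih hD with ⟨A, h₁, h₂⟩ | ⟨Ξ', h₁, h₂⟩
    · exact .inl ⟨A, hs h₁, hs h₂⟩
    · exact .inr ⟨Ξ', fun a ha => hs (h₁ ha), h₂⟩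
  | contraction Γ h D ih =>
    rcases ih hD with ⟨A, h₁, h₂⟩ | ⟨Ξ', h₁, h₂⟩
    · exact .inl ⟨A, (h.1 _).2 h₁, (h.1 _).2 h₂⟩
    · exact .inr ⟨Ξ', fun a ha => (h.1 _).2 (h₁ ha), h₂⟩
  | logical => exact hD.elim
  | mcut Γ Δ C p q hp hq h D₁ D₂ ih₁ ih₂ =>
    subst h
    simp only [mem_add, mem_replicate, LFormula.mk.injEq, ne_eq, hp, hq, not_false_eq_true,
      true_and, reduceCtorEq, false_and, or_false] at ih₁ ih₂ ⊢
    rcases ih₁ hD.1 with ⟨A, h₁, h₁' | rfl⟩ | ⟨Ξ₁, h₁, s₁, p₁⟩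
    · exact .inl ⟨A, .inl h₁, .inl h₁'⟩
    · rcases ih₂ hD.2 with ⟨B, h₂ | rfl, h₂'⟩ | ⟨Ξ₂, h₂, s₂, p₂⟩
      · exact .inl ⟨B, .inr h₂, .inr h₂'⟩
      · exact .inl ⟨_, .inl h₁, .inr h₂'⟩
      · refine .inr ⟨Ξ₂, fun a ha => ?_, s₂, p₂⟩
        rcases mem_add.1 (h₂ ha) with h | h
        · exact mem_add.2 (.inr h)
        · rw [eq_of_mem_replicate h]
          exact mem_add.2 (.inl h₁)
    rcases ih₂ hD.2 with ⟨A, h₂ | rfl, h₂'⟩ | ⟨Ξ₂, h₂, s₂, p₂⟩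
    · exact .inl ⟨A, .inr h₂, .inr h₂'⟩
    · refine .inr ⟨Ξ₁, fun a ha => ?_, s₁, p₁⟩
      rcases mem_add.1 (h₁ ha) with h | h
      · exact mem_add.2 (.inl h)
      · rw [eq_of_mem_replicate h]
        exact mem_add.2 (.inr h₂')
    right
    -- If `C` is absent, `Ξ₁` already lies in the conclusion; if present, it has degree below `d`
    -- and may be cut.
    by_cases m₁ : ⟨Side.right, C⟩ ∈ Ξ₁
    swap
    · refine ⟨Ξ₁, fun a ha => mem_add.2 (.inl ?_), s₁, p₁⟩
      refine (mem_add.1 (h₁ ha)).resolve_right fun h => m₁ ?_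
      rwa [← eq_of_mem_replicate h]
    classical
    refine ⟨Ξ₁.filter (· ≠ ⟨Side.right, C⟩) + Ξ₂.filter (· ≠ ⟨Side.left, C⟩), ?_, ?_, ?_⟩
    · intro a ha
      simp only [mem_add, mem_filter] at ha ⊢
      refine ha.imp (fun h => ?_) (fun h => ?_)
      · exact (mem_add.1 (h₁ h.1)).resolve_right fun h' => h.2 (eq_of_mem_replicate h')
      · exact (mem_add.1 (h₂ h.1)).resolve_right fun h' => h.2 (eq_of_mem_replicate h')
    · intro a ha
      simp only [mem_add, mem_filter] at ha
      exact ha.elim (fun h => s₁ a h.1) (fun h => s₂ a h.1)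
    · refine cut Side.right p₁ p₂ ?_ ?_ (.inr (s₁ _ m₁))
      · intro a ha
        simp only [mem_add, mem_filter] at ha ⊢
        tauto
      · intro a ha
        simp only [mem_add, mem_filter, Side.flip] at ha ⊢
        tauto

/-- At the empty sequent no formula is on both sides and `Ξ'` is empty, so the simulated deduction
proves `Θ` itself. Auxiliary formulas have degree below `d` as proper subformulas of `C`. -/
theorem of_principal (hS : S.PrincipalCaseReductions) {c : L.Conn} {C : Formula V L}
    (hd : C.symbols = d) {Θ : Sequent V L} (k : Side)
    {Λ : Fin (S.rule k c).arity → Sequent V L} {Ξ : Fin (S.rule k.flip c).arity → Sequent V L}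
    (hΛ : (C, Λ) ∈ (S.rule k c).tuples) (hΞ : (C, Ξ) ∈ (S.rule k.flip c).tuples)
    (pΛ : ∀ m, ReducedProvable S d r (Θ + Λ m)) (pΞ : ∀ n, ReducedProvable S d r (Θ + Ξ n)) :
    ReducedProvable S d r Θ := by
  have key : ∃ D : Deduction S (Set.range Λ ∪ Set.range Ξ) 0, D.OnlyStructural := by
    cases k
    · exact hS c C Λ Ξ hΛ hΞ
    · rw [Set.union_comm]
      exact hS c C Ξ Λ hΞ hΛ
  obtain ⟨D, hD⟩ := key
  have := of_onlyStructural (Θ := Θ) (d := d) (r := r) ?_ D hD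
  · rcases this with ⟨A, h, _⟩ | ⟨Ξ', h, _, h'⟩
    · exact absurd h (notMem_zero _)
    · exact h'.mono fun a ha => (mem_add.1 ha).elim id fun h' => absurd (h h') (notMem_zero _)
  · subst hd
    rintro _ (⟨m, rfl⟩ | ⟨m, rfl⟩)
    · exact ⟨pΛ m, fun a ha => ((S.rule _ c).auxiliary C Λ hΛ m a ha).symbols_lt⟩
    · exact ⟨pΞ m, fun a ha => ((S.rule _ c).auxiliary C Ξ hΞ m a ha).symbols_lt⟩

/-- Both premises end in rules with principal formula `C`. -/
theorem of_endsIn (hS : S.PrincipalCaseReductions) {C : Formula V L} (hd : C.symbols = d)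
    {Θ₁ Θ₂ Θ : Sequent V L} (k : Side) (D₁ : Proof S Θ₁) (D₂ : Proof S Θ₂)
    (h₁ : D₁.LocallyAnalytic) (h₂ : D₂.LocallyAnalytic)
    (hr : D₁.size + D₂.size ≤ r) (c₁ : CoveredBy ⟨k, C⟩ Θ₁ Θ)
    (c₂ : CoveredBy ⟨k.flip, C⟩ Θ₂ Θ) (e₁ : D₁.EndsIn k C) (e₂ : D₂.EndsIn k.flip C) :
    ReducedProvable S d r Θ := by
  obtain ⟨c, Γ, Λ, ht, -, hΘ₁, hp⟩ := e₁.exists_premises h₁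
  obtain ⟨c', Δ, Ξ, ht', -, hΘ₂, hp'⟩ := e₂.exists_premises h₂
  obtain rfl : c = c' := ((S.rule _ _).principal _ _ ht).unique ((S.rule _ _).principal _ _ ht')
  have key : ∀ {a : LFormula V L} {Γ' Θ' Λ' : Sequent V L}, CoveredBy a Θ' Θ → Γ' ⊆ Θ' →
      CoveredBy a (Γ' + Λ') (Θ + Λ') := by
    intro a Γ' Θ' Λ' h hs b hb
    rcases mem_add.1 hb with hb | hb
    · exact (h b (hs hb)).imp_right fun h => mem_add.2 (.inl h)
    · exact .inr (mem_add.2 (.inr hb))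
  have weak : ∀ {a : LFormula V L} {Θ' : Sequent V L} (Λ' : Sequent V L), CoveredBy a Θ' Θ →
      CoveredBy a Θ' (Θ + Λ') := fun _ h b hb => (h b hb).imp_right fun h => mem_add.2 (.inl h)
  -- The cross cuts also remove copies of `C` remaining in the rule contexts. They have degree `d`
  -- but smaller rank, and stand above cuts of degree below `d` only.
  refine of_principal hS hd k ht ht' (fun m => ?_) fun n => ?_
  · obtain ⟨D, hD, hs⟩ := hp m
    refine mcut k hd D D₂ hD h₂ (by omega) (key c₁ ?_) (weak _ c₂)
    intro a ha
    simp [hΘ₁, ha]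
  · obtain ⟨D, hD, hs⟩ := hp' n
    refine mcut k hd D₁ D h₁ hD (by omega) (weak _ c₁) (key c₂ ?_)
    intro a ha
    simp [hΘ₂, ha]

/-! ### Permuting a cut upwards -/

/-- The multicut is permuted above the last inference of the first premise. -/
theorem of_not_endsIn {C : Formula V L} (hd : C.symbols = d) {Θ₁ Θ₂ Θ : Sequent V L} (k : Side)
    (D₁ : Proof S Θ₁) (D₂ : Proof S Θ₂) (h₁ : D₁.LocallyAnalytic) (h₂ : D₂.LocallyAnalytic)
    (hr : D₁.size + D₂.size ≤ r) (hC : ¬ AnalyticCut C Θ) (c₁ : CoveredBy ⟨k, C⟩ Θ₁ Θ)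
    (c₂ : CoveredBy ⟨k.flip, C⟩ Θ₂ Θ) (e₁ : ¬ D₁.EndsIn k C)
    (hctx : ∀ k' c', (⟨k, C⟩ : LFormula V L) ∈ (S.rule k' c').context →
      ∀ a ∈ Θ₂, a ≠ ⟨k.flip, C⟩ → a ∈ (S.rule k' c').context) :
    ReducedProvable S d r Θ := by
  by_cases m₁ : ⟨k, C⟩ ∈ Θ₁
  swap
  · exact mono ⟨D₁, h₁.reduced d r⟩ fun a ha =>
      (c₁ a ha).resolve_left (by rintro rfl; exact m₁ ha)
  have key : ∀ {a : LFormula V L} {Γ' Θ' Λ' : Sequent V L}, CoveredBy a Θ' Θ → Γ' ⊆ Θ' →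
      CoveredBy a (Γ' + Λ') (Θ + Λ') := by
    intro a Γ' Θ' Λ' h hs b hb
    rcases mem_add.1 hb with hb | hb
    · exact (h b (hs hb)).imp_right fun h => mem_add.2 (.inl h)
    · exact .inr (mem_add.2 (.inr hb))
  have weak : ∀ {a : LFormula V L} {Θ' : Sequent V L} (Λ' : Sequent V L), CoveredBy a Θ' Θ →
      CoveredBy a Θ' (Θ + Λ') := fun _ h b hb => (h b hb).imp_right fun h => mem_add.2 (.inl h)
  cases D₁ with
  | assumption h => exact h.elim
  | ident x h =>
    subst h
    -- The initial sequent contains `C` with both labels; the opposite copy survives in `Θ` and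
    -- would make the cut analytic.
    refine absurd ⟨⟨k.flip, C⟩, (c₁ _ (flip_mem_ident m₁)).resolve_left ?_, .refl _⟩ hC
    simpa using k.flip_ne
  | weakening Γ Δ h D =>
    subst h
    exact mcut k hd D D₂ h₁ h₂ (by simp only [size] at hr; omega)
      (fun a ha => c₁ a (mem_add.2 (.inl ha))) c₂
  | contraction Γ h D =>
    exact mcut k hd D D₂ h₁ h₂ (by simp only [size] at hr; omega)
      (fun a ha => c₁ a ((h.1 a).2 ha)) c₂
  | mcut Γ Δ E p q hp hq h D D' =>
    subst h
    obtain ⟨hE, hD, hD'⟩ := h₁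
    simp only [size] at hr
    have sΓ : Γ ⊆ Γ + Δ := fun a ha => mem_add.2 (.inl ha)
    have sΔ : Δ ⊆ Γ + Δ := fun a ha => mem_add.2 (.inr ha)
    by_cases hEC : E = C
    -- For a cut on `C` itself, the premise in which it is cut with label `k` suffices: the extra
    -- copies are absorbed by the cover, and the other premise is dropped.
    · subst hEC
      cases k
      · refine mcut Side.left hd D' D₂ hD' h₂ (by omega) (fun a ha => ?_) c₂
        rcases mem_add.1 ha with ha | ha
        · exact c₁ a (sΔ ha)
        · exact .inl (eq_of_mem_replicate ha)
      · refine mcut Side.right hd D D₂ hD h₂ (by omega) (fun a ha => ?_) c₂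
        rcases mem_add.1 ha with ha | ha
        · exact c₁ a (sΓ ha)
        · exact .inl (eq_of_mem_replicate ha)
    -- The cut may have been analytic only because of `C`; then `E` is a proper subformula of `C`.
    · have hE' : AnalyticCut E Θ ∨ E.symbols < d := by
        obtain ⟨a, ha, hs⟩ := hE
        rcases c₁ a ha with rfl | ha
        · exact .inr (hd ▸ Formula.ProperSubformula.symbols_lt ⟨hs, hEC⟩)
        · exact .inl ⟨a, ha, hs⟩
      refine cut Side.right (mcut k hd D D₂ hD h₂ (by omega) (key c₁ sΓ) (weak _ c₂))
        (mcut k hd D' D₂ hD' h₂ (by omega) (key c₁ sΔ) (weak _ c₂)) ?_ ?_ hE'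
      · exact fun a ha => (mem_add.1 ha).symm.imp_left eq_of_mem_replicate
      · exact fun a ha => (mem_add.1 ha).symm.imp_left eq_of_mem_replicate
  | logical k' c' Γ C' Λ ht hΓ h D =>
    subst h
    classical
    have hne : (⟨k', C'⟩ : LFormula V L) ≠ ⟨k, C⟩ := fun h => e₁ (by cases h; exact ⟨rfl, rfl⟩)
    have hmem : ⟨k, C⟩ ∈ Γ := by
      refine (mem_add.1 m₁).resolve_right fun h => hne (mem_singleton.1 h).symm
    have hctx' := hctx k' c' (hΓ _ hmem)
    -- The rule is applied in its own context with `C` replaced by the rest of `Θ₂`; all of `Θ`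
    -- might violate the restriction.
    refine logical (Γ := Γ.filter (· ≠ ⟨k, C⟩) + Θ₂.filter (· ≠ ⟨k.flip, C⟩)) ht
      (fun a ha => ?_) (fun a ha => ?_) ?_ fun m => ?_
    · simp only [mem_add, mem_filter] at ha
      exact ha.elim (fun h => hΓ a h.1) (fun h => hctx' a h.1 h.2)
    · simp only [mem_add, mem_filter] at ha
      refine ha.elim (fun h => (c₁ a ?_).resolve_left h.2) fun h => (c₂ a h.1).resolve_left h.2
      exact mem_add.2 (.inl h.1)
    · exact (c₁ _ (by simp)).resolve_left hne
    · have := size_lt_logical (ht := ht) (hΓ := hΓ) (h := rfl) D m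
      refine mcut k hd (D m) D₂ (h₁ m) h₂ (by omega) ?_ ?_
      · intro a ha
        simp only [mem_add, mem_filter] at ha ⊢
        tauto
      · intro a ha
        simp only [mem_add, mem_filter] at ha ⊢
        tauto

end ReducedProvable

open ReducedProvable

/-! ### Tracing the cut formula to its principal occurrences -/

variable {S : StandardCalculus V L} {d r : ℕ}

/-- In a locally analytic proof the occurrences of `C` labelled `k` can be replaced by formulas
from `F`, if these meet the flipped contexts of all inferences in which `C` is principal. -/
theorem exists_principal_contexts (hS : S.AxiomExpansion) {C : Formula V L} (hd : C.symbols = d)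
    (k : Side) (F : Set (LFormula V L)) (U : Set (Formula V L))
    (hF : ∀ k' c', (⟨k, C⟩ : LFormula V L) ∈ (S.rule k' c').context →
      F ⊆ (S.rule k' c').context)
    (hU : ∀ A B, A.Subformula B → B ∈ U → A ∈ U) (hCU : C ∉ U)
    (hUC : ∀ A, A.ProperSubformula C → A ∈ U)
    {Θ' : Sequent V L} (D : Proof S Θ') (hD : D.LocallyAnalytic)
    (Θ : Sequent V L) (hΘ : ∀ a ∈ Θ, a.form ∈ U) (hc : CoveredBy ⟨k, C⟩ Θ' Θ) :
    ∃ 𝒢 : Set (Sequent V L), 𝒢.Finite ∧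
      (∀ G ∈ 𝒢, ∃ c, C.HasPrincipal c ∧ (∀ a ∈ G, a ∈ (S.rule k c).context) ∧
        (∀ a ∈ G, a.form ∈ U) ∧ ∃ (Ξ : Sequent V L) (E : Proof S Ξ), E.LocallyAnalytic ∧
          E.size ≤ D.size ∧ (¬ D.EndsIn k C → E.size < D.size) ∧ CoveredBy ⟨k, C⟩ Ξ G) ∧
      ∀ T : Sequent V L, (∀ a ∈ T, a ∈ F) → (∀ G ∈ 𝒢, ∃ a ∈ G, a.flip ∈ T) →
        ReducedProvable S d r (Θ + T) := by
  classical
  -- `Θ` varies along the branches, so `U` provides a fixed bound on the formulas in the collected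
  -- contexts: it is closed under subformulas and excludes `C`. Tracing stops at the first inference
  -- reached with `C` principal.
  induction D generalizing Θ with
  | assumption h => exact h.elim
  | ident x h =>
    subst h
    by_cases m : ⟨k, C⟩ ∈ ({⟨Side.left, .var x⟩, ⟨Side.right, .var x⟩} : Sequent V L)
    · refine absurd (hΘ ⟨k.flip, C⟩ ((hc _ (flip_mem_ident m)).resolve_left ?_)) hCU
      simpa using k.flip_ne
    · refine ⟨∅, Set.finite_empty, by simp, fun T _ _ => mono ⟨_, hD.reduced d r⟩ fun a ha => ?_⟩
      exact mem_add.2 (.inl ((hc a ha).resolve_left (by rintro rfl; exact m ha)))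
  | weakening Γ Δ h D ih =>
    subst h
    obtain ⟨𝒢, fin, h𝒢, hT⟩ := ih hD Θ hΘ fun a ha => hc a (mem_add.2 (.inl ha))
    refine ⟨𝒢, fin, fun G hG => ?_, hT⟩
    obtain ⟨c, hc, hG, hGU, Ξ, E, hE, hs, -, hΞ⟩ := h𝒢 G hG
    exact ⟨c, hc, hG, hGU, Ξ, E, hE, by simp only [size]; omega,
      fun _ => by simp only [size]; omega, hΞ⟩
  | contraction Γ h D ih =>
    obtain ⟨𝒢, fin, h𝒢, hT⟩ := ih hD Θ hΘ fun a ha => hc a ((h.1 a).2 ha)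
    refine ⟨𝒢, fin, fun G hG => ?_, hT⟩
    obtain ⟨c, hc, hG, hGU, Ξ, E, hE, hs, -, hΞ⟩ := h𝒢 G hG
    exact ⟨c, hc, hG, hGU, Ξ, E, hE, by simp only [size]; omega,
      fun _ => by simp only [size]; omega, hΞ⟩
  | mcut Γ Δ E p q hp hq h D₁ D₂ ih₁ ih₂ =>
    subst h
    obtain ⟨hE, hD₁, hD₂⟩ := hD
    have sΓ : Γ ⊆ Γ + Δ := fun a ha => mem_add.2 (.inl ha)
    have sΔ : Δ ⊆ Γ + Δ := fun a ha => mem_add.2 (.inr ha)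
    by_cases hEC : E = C
    · subst hEC
      cases k
      · obtain ⟨𝒢, fin, h𝒢, hT⟩ := ih₂ hD₂ Θ hΘ fun a ha =>
          (mem_add.1 ha).symm.elim (fun h => .inl (eq_of_mem_replicate h)) fun h => hc a (sΔ h)
        refine ⟨𝒢, fin, fun G hG => ?_, hT⟩
        obtain ⟨c, hc, hG, hGU, Ξ, E, hE, hs, -, hΞ⟩ := h𝒢 G hG
        exact ⟨c, hc, hG, hGU, Ξ, E, hE, by simp only [size]; omega,
          fun _ => by simp only [size]; omega, hΞ⟩
      · obtain ⟨𝒢, fin, h𝒢, hT⟩ := ih₁ hD₁ Θ hΘ fun a ha =>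
          (mem_add.1 ha).symm.elim (fun h => .inl (eq_of_mem_replicate h)) fun h => hc a (sΓ h)
        refine ⟨𝒢, fin, fun G hG => ?_, hT⟩
        obtain ⟨c, hc, hG, hGU, Ξ, E, hE, hs, -, hΞ⟩ := h𝒢 G hG
        exact ⟨c, hc, hG, hGU, Ξ, E, hE, by simp only [size]; omega,
          fun _ => by simp only [size]; omega, hΞ⟩
    have hEU : E ∈ U ∧ (AnalyticCut E Θ ∨ E.symbols < d) := by
      obtain ⟨a, ha, hs⟩ := hE
      rcases hc a ha with rfl | ha
      · exact ⟨hUC E ⟨hs, hEC⟩, .inr (hd ▸ Formula.ProperSubformula.symbols_lt ⟨hs, hEC⟩)⟩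
      · exact ⟨hU _ _ hs (hΘ a ha), .inl ⟨a, ha, hs⟩⟩
    have hΘ' : ∀ k', ∀ a ∈ Θ + {⟨k', E⟩}, a.form ∈ U := by
      intro k' a ha
      rcases mem_add.1 ha with ha | ha
      · exact hΘ a ha
      · rw [mem_singleton.1 ha]
        exact hEU.1
    have cov : ∀ {Γ' : Sequent V L} {k' : Side} {n : ℕ}, Γ' ⊆ Γ + Δ →
        CoveredBy ⟨k, C⟩ (Γ' + replicate n ⟨k', E⟩) (Θ + {⟨k', E⟩}) := by
      intro Γ' k' n hs a ha
      rcases mem_add.1 ha with ha | ha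
      · exact (hc a (hs ha)).imp_right fun h => mem_add.2 (.inl h)
      · exact .inr (mem_add.2 (.inr (mem_singleton.2 (eq_of_mem_replicate ha))))
    obtain ⟨𝒢₁, fin₁, h𝒢₁, hT₁⟩ := ih₁ hD₁ _ (hΘ' _) (cov sΓ)
    obtain ⟨𝒢₂, fin₂, h𝒢₂, hT₂⟩ := ih₂ hD₂ _ (hΘ' _) (cov sΔ)
    refine ⟨𝒢₁ ∪ 𝒢₂, fin₁.union fin₂, ?_, fun T hTF hT => ?_⟩
    · rintro G (hG | hG)
      · obtain ⟨c, hc, hG, hGU, Ξ, E, hE, hs, -, hΞ⟩ := h𝒢₁ G hG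
        exact ⟨c, hc, hG, hGU, Ξ, E, hE, by simp only [size]; omega,
          fun _ => by simp only [size]; omega, hΞ⟩
      · obtain ⟨c, hc, hG, hGU, Ξ, E, hE, hs, -, hΞ⟩ := h𝒢₂ G hG
        exact ⟨c, hc, hG, hGU, Ξ, E, hE, by simp only [size]; omega,
          fun _ => by simp only [size]; omega, hΞ⟩
    · refine cut Side.right (hT₁ T hTF fun G hG => hT G (.inl hG))
        (hT₂ T hTF fun G hG => hT G (.inr hG)) ?_ ?_
        (hEU.2.imp_left fun ⟨a, ha, hs⟩ => ⟨a, mem_add.2 (.inl ha), hs⟩)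
      · intro a ha
        simp only [mem_add, mem_singleton] at ha ⊢
        tauto
      · intro a ha
        simp only [mem_add, mem_singleton, Side.flip] at ha ⊢
        tauto
  | logical k' c Γ C' Λ ht hΓ h D ih =>
    subst h
    by_cases hp : k' = k ∧ C' = C
    · obtain ⟨rfl, rfl⟩ := hp
      have hG : ∀ a ∈ Γ.filter (· ≠ ⟨k', C'⟩), a ∈ Θ := fun a ha =>
        (hc a (mem_add.2 (.inl (mem_filter.1 ha).1))).resolve_left (mem_filter.1 ha).2
      refine ⟨{Γ.filter (· ≠ ⟨k', C'⟩)}, Set.finite_singleton _, ?_, fun T _ hT => ?_⟩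
      · rintro _ rfl
        refine ⟨c, (S.rule _ _).principal _ _ ht, fun a ha => hΓ a (mem_filter.1 ha).1,
          fun a ha => hΘ a (hG a ha), _, _, hD, le_rfl, fun h => absurd ⟨rfl, rfl⟩ h, ?_⟩
        intro a ha
        simp only [mem_add, mem_singleton, mem_filter] at ha ⊢
        tauto
      -- The context formula `a` and its flip both occur in `Θ + T`, so a cut-free identity replaces
      -- the whole subproof.
      · obtain ⟨a, ha, haT⟩ := hT _ rfl
        obtain ⟨D', hD'⟩ := hS a.form
        refine mono ⟨D', AllCuts.reduced r (hD'.mono fun _ _ => False.elim)⟩ ?_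
        have ha' : a ∈ Θ + T := mem_add.2 (.inl (hG a ha))
        have hb' : a.flip ∈ Θ + T := mem_add.2 (.inr haT)
        rcases a with ⟨_ | _, A⟩ <;> intro b hb <;>
          simp only [insert_eq_cons, mem_cons, mem_singleton] at hb <;>
          rcases hb with rfl | rfl <;> assumption
    have hne : (⟨k', C'⟩ : LFormula V L) ≠ ⟨k, C⟩ := fun h => hp (by cases h; exact ⟨rfl, rfl⟩)
    by_cases m : ⟨k, C⟩ ∈ Γ
    swap
    · refine ⟨∅, Set.finite_empty, by simp, fun T _ _ => mono ⟨_, hD.reduced d r⟩ fun a ha => ?_⟩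
      refine mem_add.2 (.inl ((hc a ha).resolve_left ?_))
      rintro rfl
      exact (mem_add.1 ha).elim m fun h => hne (mem_singleton.1 h).symm
    have hC' : ⟨k', C'⟩ ∈ Θ := (hc _ (by simp)).resolve_left hne
    have hG : ∀ a ∈ Γ.filter (· ≠ ⟨k, C⟩), a ∈ Θ := fun a ha =>
      (hc a (mem_add.2 (.inl (mem_filter.1 ha).1))).resolve_left (mem_filter.1 ha).2
    have ih' := fun m => ih m (hD m) (Γ.filter (· ≠ ⟨k, C⟩) + Λ m)
      (fun a ha => (mem_add.1 ha).elim (fun h => hΘ a (hG a h)) fun h =>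
        hU _ _ ((S.rule _ _).auxiliary _ _ ht m a h).1 (hΘ _ hC'))
      (fun a ha => by
        simp only [mem_add, mem_filter] at ha ⊢
        tauto)
    choose 𝒢 fin h𝒢 hT using ih'
    refine ⟨⋃ m, 𝒢 m, Set.finite_iUnion fin, fun G hG => ?_, fun T hTF hT' => ?_⟩
    · obtain ⟨m, hG⟩ := Set.mem_iUnion.1 hG
      obtain ⟨c, hc, hG, hGU, Ξ, E, hE, hs, -, hΞ⟩ := h𝒢 m G hG
      have := size_lt_logical (ht := ht) (hΓ := hΓ) (h := rfl) D m
      exact ⟨c, hc, hG, hGU, Ξ, E, hE, by omega, fun _ => by omega, hΞ⟩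
    · refine logical (Γ := Γ.filter (· ≠ ⟨k, C⟩) + T) ht (fun a ha => ?_) (fun a ha => ?_)
        (mem_add.2 (.inl hC')) fun m => ?_
      -- Since the rule admits `C` in its context, it admits all of `F`, hence `T`.
      · exact (mem_add.1 ha).elim (fun h => hΓ a (mem_filter.1 h).1) fun h =>
          hF _ _ (hΓ _ m) (hTF a h)
      · exact mem_add.2 ((mem_add.1 ha).imp_left (hG a))
      · rw [add_right_comm]
        exact hT m T hTF fun G hG => hT' G (Set.mem_iUnion.2 ⟨m, hG⟩)

/-- Cuts with the formulas of finitely many sequents `G`, if every selection of one flipped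
formula from each of them is refuted. -/
theorem ReducedProvable.cut_transversal {𝒢 : Set (Sequent V L)} (fin : 𝒢.Finite)
    {F : Set (LFormula V L)} (hF : ∀ G ∈ 𝒢, ∀ a ∈ G, a.flip ∈ F) (Θ : Sequent V L)
    (hU : ∀ G ∈ 𝒢, ∀ a ∈ G, AnalyticCut a.form Θ ∨ a.form.symbols < d)
    (h𝒢 : ∀ G ∈ 𝒢, ReducedProvable S d r (Θ + G))
    (h : ∀ T : Sequent V L, (∀ a ∈ T, a ∈ F) → (∀ G ∈ 𝒢, ∃ a ∈ G, a.flip ∈ T) →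
      ReducedProvable S d r (Θ + T)) : ReducedProvable S d r Θ := by
  induction 𝒢, fin using Set.Finite.induction_on generalizing Θ with
  | empty => simpa using h 0 (by simp) (by simp)
  | @insert G 𝒢 _ _ ih =>
    have hG : G ∈ insert G 𝒢 := Set.mem_insert _ _
    -- It remains to prove `Θ + {a.flip}` for each `a` in `G`: the flip joins the selection, and the
    -- other sequents are treated recursively with the enlarged `Θ`.
    refine cut_all G (h𝒢 G hG) (fun a ha => ?_) (hU G hG)
    refine ih (fun G' hG' => hF G' (.inr hG')) _ (fun G' hG' b hb => ?_) (fun G' hG' => ?_)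
      fun T hTF hT => ?_
    · exact (hU G' (.inr hG') b hb).imp_left fun ⟨e, he, hs⟩ => ⟨e, mem_add.2 (.inl he), hs⟩
    · refine (h𝒢 G' (.inr hG')).mono fun b hb => ?_
      simp only [mem_add] at hb ⊢
      tauto
    · rw [add_assoc]
      refine h _ (fun b hb => ?_) fun G' hG' => ?_
      · refine (mem_add.1 hb).elim (fun h => ?_) (hTF b)
        rw [mem_singleton.1 h]
        exact hF G hG a ha
      · rcases hG' with rfl | hG'
        · exact ⟨a, ha, mem_add.2 (.inl (mem_singleton_self _))⟩
        · obtain ⟨b, hb, hbT⟩ := hT G' hG'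
          exact ⟨b, hb, mem_add.2 (.inr hbT)⟩

/-- `exists_principal_contexts` for the set of the proper subformulas of `C` and the subformulas
of `Θ`. -/
theorem exists_principal_contexts_of_not_analyticCut (hS : S.AxiomExpansion) {C : Formula V L}
    (hd : C.symbols = d) (k : Side) (F : Set (LFormula V L))
    (hF : ∀ k' c', (⟨k, C⟩ : LFormula V L) ∈ (S.rule k' c').context →
      F ⊆ (S.rule k' c').context)
    {Θ' : Sequent V L} (D : Proof S Θ') (hD : D.LocallyAnalytic)
    (Θ : Sequent V L) (hC : ¬ AnalyticCut C Θ) (hc : CoveredBy ⟨k, C⟩ Θ' Θ) :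
    ∃ 𝒢 : Set (Sequent V L), 𝒢.Finite ∧
      (∀ G ∈ 𝒢, ∃ c, C.HasPrincipal c ∧ (∀ a ∈ G, a ∈ (S.rule k c).context) ∧
        (∀ a ∈ G, AnalyticCut a.form Θ ∨ a.form.symbols < d) ∧
        ∃ (Ξ : Sequent V L) (E : Proof S Ξ), E.LocallyAnalytic ∧
          E.size ≤ D.size ∧ (¬ D.EndsIn k C → E.size < D.size) ∧ CoveredBy ⟨k, C⟩ Ξ G) ∧
      ∀ T : Sequent V L, (∀ a ∈ T, a ∈ F) → (∀ G ∈ 𝒢, ∃ a ∈ G, a.flip ∈ T) →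
        ReducedProvable S d r (Θ + T) := by
  obtain ⟨𝒢, fin, h𝒢, hT⟩ := exists_principal_contexts (r := r) hS hd k F
    {A | A.ProperSubformula C ∨ AnalyticCut A Θ} hF
    (fun A B hAB hB => hB.imp (fun h => h.trans_left hAB)
      fun ⟨a, ha, hs⟩ => ⟨a, ha, hAB.trans hs⟩)
    (fun h => h.elim (fun h => h.2 rfl) hC) (fun A => .inl) D hD Θ
    (fun a ha => .inr ⟨a, ha, .refl _⟩) hc
  refine ⟨𝒢, fin, fun G hG => ?_, hT⟩
  obtain ⟨c, hc, hG, hGU, h⟩ := h𝒢 G hG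
  exact ⟨c, hc, hG, fun a ha => (hGU a ha).symm.imp_right fun h => hd ▸ h.symbols_lt, h⟩

/-! ### The kinds of class 2 connectives -/

namespace ReducedProvable

variable {C : Formula V L} {Θ₁ Θ₂ Θ : Sequent V L} {c : L.Conn}

/-- A variable is never principal, so no contexts are collected and the empty selection suffices:
its occurrences are simply deleted from one premise. -/
theorem of_var (hS : S.AxiomExpansion) {x : V} (hd : (Formula.var x : Formula V L).symbols = d)
    (k : Side) (D : Proof S Θ₁) (hD : D.LocallyAnalytic) (hC : ¬ AnalyticCut (.var x) Θ)
    (c₁ : CoveredBy ⟨k, .var x⟩ Θ₁ Θ) : ReducedProvable S d r Θ := by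
  obtain ⟨𝒢, -, h𝒢, hT⟩ := exists_principal_contexts_of_not_analyticCut (r := r) hS hd k ∅
    (fun _ _ _ => Set.empty_subset _) D hD Θ hC c₁
  have := hT 0 (by simp) fun G hG => by
    obtain ⟨c, ⟨args, h⟩, -⟩ := h𝒢 G hG
    cases h
  simpa using this

/-- Inversion of both premises gives all auxiliary sequents; the non-analytic cuts it introduces are
on proper subformulas of `C`, hence of degree below `d`. -/
theorem of_invertible (hS : S.PrincipalCaseReductions) (hd : C.symbols = d)
    (hCc : C.HasPrincipal c) (k : Side) (i₁ : S.Invertible k c) (i₂ : S.Invertible k.flip c)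
    (D₁ : Proof S Θ₁) (D₂ : Proof S Θ₂) (h₁ : D₁.LocallyAnalytic) (h₂ : D₂.LocallyAnalytic)
    (c₁ : CoveredBy ⟨k, C⟩ Θ₁ Θ) (c₂ : CoveredBy ⟨k.flip, C⟩ Θ₂ Θ) :
    ReducedProvable S d r Θ := by
  have key : ∀ (k : Side) {Θ₁ : Sequent V L} (D : Proof S Θ₁), D.LocallyAnalytic →
      CoveredBy ⟨k, C⟩ Θ₁ Θ → S.Invertible k c →
      ∀ Λ, (C, Λ) ∈ (S.rule k c).tuples → ∀ m, ReducedProvable S d r (Θ + Λ m) := by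
    intro k Θ₁ D hD hc hi Λ ht m
    have hcon : IsContraction (Θ + {⟨k, C⟩}) (Θ₁ + (Θ + {⟨k, C⟩})) := by
      refine ⟨fun a => ?_, Multiset.le_add_left _ _⟩
      refine ⟨fun h => mem_add.2 (.inr h), fun h => (mem_add.1 h).elim (fun h => ?_) id⟩
      exact mem_add.2 ((hc a h).symm.imp_right mem_singleton.2)
    obtain ⟨D', -, hD'⟩ := hi C Λ ht Θ (.contraction _ hcon (.weakening Θ₁ _ rfl D)) m
    exact ⟨D', AllCuts.reduced r
      ((hD' hD).mono fun _ _ h => h.imp_right fun h => hd ▸ h.symbols_lt)⟩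
  obtain ⟨Λ, hΛ⟩ := (S.rule k c).total C hCc
  obtain ⟨Ξ, hΞ⟩ := (S.rule k.flip c).total C hCc
  exact of_principal hS hd k hΛ hΞ (key k D₁ h₁ c₁ i₁ Λ hΛ) (key k.flip D₂ h₂ c₂ i₂ Ξ hΞ)

/-- The order matters: the first premise can always be permuted into, and only when it ends in `C`
are its other formulas known to satisfy the restriction that weak shiftability carries across the
rules of the second. -/
theorem of_shiftable (hS : S.PrincipalCaseReductions) (hd : C.symbols = d)
    (hCc : C.HasPrincipal c) (k : Side) (s₁ : S.Shiftable k c) (s₂ : S.WeaklyShiftable k.flip c)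
    (D₁ : Proof S Θ₁) (D₂ : Proof S Θ₂) (h₁ : D₁.LocallyAnalytic) (h₂ : D₂.LocallyAnalytic)
    (hr : D₁.size + D₂.size ≤ r) (hC : ¬ AnalyticCut C Θ)
    (c₁ : CoveredBy ⟨k, C⟩ Θ₁ Θ) (c₂ : CoveredBy ⟨k.flip, C⟩ Θ₂ Θ) :
    ReducedProvable S d r Θ := by
  by_cases e₁ : D₁.EndsIn k C
  swap
  · refine of_not_endsIn hd k D₁ D₂ h₁ h₂ hr hC c₁ c₂ e₁ fun k' c' h a _ _ => ?_
    rw [s₁ C hCc k' c' h]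
    trivial
  by_cases e₂ : D₂.EndsIn k.flip C
  swap
  · refine of_not_endsIn hd k.flip D₂ D₁ h₂ h₁ (by omega) hC c₂ (by simpa using c₁) e₂
      fun k' c' h a ha hne => ?_
    have := s₂ C hCc k' c' h
    rw [Side.flip_flip] at this hne
    exact this (e₁.mem_context h₁ hCc a ha hne)
  exact of_endsIn hS hd k D₁ D₂ h₁ h₂ hr c₁ c₂ e₁ e₂

/-- If the second premise ends in `C`, weak shiftability lets the cut move into the first. Otherwise
nothing is known about the formulas to be moved, and `C` is traced in the second premise instead. -/
theorem of_inverseShiftable (hS : S.PrincipalCaseReductions) (hA : S.AxiomExpansion)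
    (hd : C.symbols = d) (hCc : C.HasPrincipal c) (k : Side) (s₁ : S.WeaklyShiftable k c)
    (s₂ : S.InverseShiftable k.flip c)
    (D₁ : Proof S Θ₁) (D₂ : Proof S Θ₂) (h₁ : D₁.LocallyAnalytic) (h₂ : D₂.LocallyAnalytic)
    (hr : D₁.size + D₂.size ≤ r) (hC : ¬ AnalyticCut C Θ)
    (c₁ : CoveredBy ⟨k, C⟩ Θ₁ Θ) (c₂ : CoveredBy ⟨k.flip, C⟩ Θ₂ Θ) :
    ReducedProvable S d r Θ := by
  by_cases e₂ : D₂.EndsIn k.flip C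
  · by_cases e₁ : D₁.EndsIn k C
    · exact of_endsIn hS hd k D₁ D₂ h₁ h₂ hr c₁ c₂ e₁ e₂
    · exact of_not_endsIn hd k D₁ D₂ h₁ h₂ hr hC c₁ c₂ e₁ fun k' c' h a ha hne =>
        s₁ C hCc k' c' h (e₂.mem_context h₂ hCc a ha hne)
  obtain ⟨𝒢, fin, h𝒢, hT⟩ := exists_principal_contexts_of_not_analyticCut (r := r) hA hd k.flip
    (LFormula.flip '' (S.rule k.flip c).context) (s₂ C hCc) D₂ h₂ Θ hC c₂
  refine cut_transversal fin (fun G hG a ha => ?_) Θ (fun G hG => ?_) (fun G hG => ?_) hT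
  · obtain ⟨c', hc', hG, -⟩ := h𝒢 G hG
    obtain rfl := hCc.unique hc'
    exact ⟨a, hG a ha, rfl⟩
  · obtain ⟨_, _, _, h, _⟩ := h𝒢 G hG
    exact h
  · obtain ⟨_, _, _, _, Ξ, E, hE, -, hs, hΞ⟩ := h𝒢 G hG
    -- As `D₂` does not end in `C`, the traced subproof `E` is strictly smaller, so its cut with
    -- `D₁` has rank below `r`.
    have := hs e₂
    exact mcut k hd D₁ E h₁ hE (by omega)
      (fun a ha => (c₁ a ha).imp_right fun h => mem_add.2 (.inl h))
      (fun a ha => (hΞ a ha).imp_right fun h => mem_add.2 (.inr h))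

theorem of_isClassTwo (hS : S.IsClassTwo) (hd : C.symbols = d)
    (D₁ : Proof S Θ₁) (D₂ : Proof S Θ₂) (h₁ : D₁.LocallyAnalytic) (h₂ : D₂.LocallyAnalytic)
    (hr : D₁.size + D₂.size ≤ r) (hC : ¬ AnalyticCut C Θ)
    (c₁ : CoveredBy ⟨Side.right, C⟩ Θ₁ Θ) (c₂ : CoveredBy ⟨Side.left, C⟩ Θ₂ Θ) :
    ReducedProvable S d r Θ := by
  obtain ⟨-, hP, hA, hconn⟩ := hS
  cases C with
  | var x => exact of_var hA hd Side.right D₁ h₁ hC c₁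
  | app c args =>
    have hCc : (Formula.app c args : Formula V L).HasPrincipal c := ⟨args, rfl⟩
    have hr' : D₂.size + D₁.size ≤ r := by omega
    rcases hconn c with (⟨il, ir⟩ | ⟨s, w⟩ | ⟨s, w⟩) | ⟨w, i⟩ | ⟨w, i⟩
    · exact of_invertible hP hd hCc Side.left il ir D₂ D₁ h₂ h₁ c₂ c₁
    · exact of_shiftable hP hd hCc Side.left s w D₂ D₁ h₂ h₁ hr' hC c₂ c₁
    · exact of_shiftable hP hd hCc Side.right s w D₁ D₂ h₁ h₂ hr hC c₁ c₂
    · exact of_inverseShiftable hP hA hd hCc Side.left w i D₂ D₁ h₂ h₁ hr' hC c₂ c₁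
    · exact of_inverseShiftable hP hA hd hCc Side.right w i D₁ D₂ h₁ h₂ hr hC c₁ c₂

end ReducedProvable

end CutRestriction

theorem mainTheorem2 {V : Type*} {L : CutRestriction.PropLanguage}
    (S : CutRestriction.StandardCalculus V L) (hS : S.IsClassTwo) (d r : ℕ)
    (Θ : CutRestriction.Sequent V L) (β : CutRestriction.Proof S Θ)
    (hβ : β.OnlyLastCutNonAnalytic d r) :
    ∃ β' : CutRestriction.Proof S Θ, β'.Reduced d r := by
  cases β with
  | mcut Γ Δ C p q hp hq h D₁ D₂ =>
    obtain ⟨hC, hd, hr, h₁, h₂⟩ := hβ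
    subst h
    refine CutRestriction.ReducedProvable.of_isClassTwo hS hd D₁ D₂ h₁ h₂ hr.le hC ?_ ?_
    · exact fun a ha => (Multiset.mem_add.1 ha).elim
        (fun h => .inr (Multiset.mem_add.2 (.inl h))) fun h => .inl (Multiset.eq_of_mem_replicate h)
    · exact fun a ha => (Multiset.mem_add.1 ha).elim
        (fun h => .inr (Multiset.mem_add.2 (.inr h))) fun h => .inl (Multiset.eq_of_mem_replicate h)
  | _ => exact hβ.elim
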